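/- Let $K$ be the polynomial of unoriented link diagrams with values in $\mathbb{Z}[a^{\pm1},z^{\pm1}]$ that underlies the two-variable Kauffman polynomial. That is, $K$ is invariant under planar isotopy and under the second and third Reidemeister moves, it satisfies $K(L_+)+K(L_-)=z\,(K(L_a)+K(L_b))$ for diagrams that differ only at one crossing ($L_+$, $L_-$ are the two crossings and $L_a$, $L_b$ the two smoothings), removing a positive kink gives $K(L_{pos})=a^{-1}K(L)$ and removing a negative kink gives $K(L_{neg})=a\,K(L)$, the disjoint union with a crossingless circle $O$ satisfies $K(L\sqcup O)=\left(\frac{a+a^{-1}}{z}-1\right)K(L)$, and $K(O)=1$. For $q\ge 0$ let $T(2,q)$ be the closure of the two-strand braid $\sigma_1^{q}$, all of whose crossings are positive, and write $K(2,q)=K(T(2,q))$. For $q\ge 2$ let $P_q\in\mathbb{Z}[L,\ell,D,d]$ be the sum of the activity words of all perfect matchings of the balanced overlaid Tait graph of $T(2,q)$. This is the bipartite graph formed by the crossings $v_1,\dots,v_q$ of the diagram, ordered from top to bottom, and by its faces, coloured like a checkerboard with the outside face unshaded, where a crossing is adjacent to the faces that it touches; the shaded face between the right-hand closing strands and the unshaded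 face between the braid and the closing strands are omitted. An edge from a shaded face has the letter $L$ if its crossing is the first one adjacent to that face, and $D$ otherwise; an edge from an unshaded face has the letter $\ell$ if its crossing is the first one adjacent to that face, and $d$ otherwise. The activity word of a matching is the product of the letters of its edges. (Explicitly, $P_q=\ell D^{q-1}+\sum_{i=1}^{q-1} d\,L^{i}D^{q-1-i}$.) Then, for every $q\ge 2$, $$K(2,q)=P_q-\sum_{i=0}^{q-2} z^{\,q-2-i}\,K(2,i),$$ where $P_q$ is specialized by $L=a=\ell^{-1}$ and $D=d=z$. For the mirror images $T(2,-q)$, the closures of $\sigma_1^{-q}$, one has likewise $$K(2,-q)=P_q-\sum_{i=0}^{q-2} z^{\,q-2-i}\,K(2,-i),$$ where the same $P_q$ is specialized by $L=a^{-1}=\ell^{-1}$ and $D=d=z$. Both identities also hold between the classes $[\,\cdot\,]$ of the diagrams in the Kauffman skein module (the free $\mathbb{Z}[a^{\pm1},z^{\pm1}]$-module on nonempty link diagrams modulo the relations above other than $K(O)=1$), with $P_q$ replaced by $P_q\cdot[O]$. -/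

import Mathlib

namespace Knot

/-! ### Link diagrams

A link diagram in the plane in general position with respect to the height function is cut by
horizontal lines into slices, each with one local maximum, one local minimum or one crossing.
It is read from top to bottom. Strands at a given level are numbered `0, 1, 2, …` from the left. -/

/-- The three kinds of slices. For `s = 1`, `crossing s` is the braid generator `σ`, and for
`s = -1` it is its inverse `σ⁻¹`; the sign of the crossing is `s` if both strands are
oriented downwards. -/
inductive SliceKind : Type
  | max : SliceKind
  | min : SliceKind
  | crossing (s : ℤˣ) : SliceKind

/-- The number of strands entering from above. -/
def SliceKind.inputs : SliceKind → ℕ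
  | .max => 0
  | .min => 2
  | .crossing _ => 2

/-- The number of strands leaving below. -/
def SliceKind.outputs : SliceKind → ℕ
  | .max => 2
  | .min => 0
  | .crossing _ => 2

/-- A slice: exactly `pos` vertical strands stand to the left of its maximum, minimum or
crossing. -/
structure Slice : Type where
  kind : SliceKind
  pos : ℕ

abbrev maxAt (i : ℕ) : Slice := ⟨.max, i⟩

abbrev minAt (i : ℕ) : Slice := ⟨.min, i⟩

abbrev crossAt (s : ℤˣ) (i : ℕ) : Slice := ⟨.crossing s, i⟩

/-- `IsTangle w m n`: the word `w` is a tangle diagram with `m` strands at the top and `n`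
strands at the bottom. -/
def IsTangle : List Slice → ℕ → ℕ → Prop
  | [], m, n => m = n
  | s :: w, m, n =>
      s.pos + s.kind.inputs ≤ m ∧ IsTangle w (m - s.kind.inputs + s.kind.outputs) n

/-- A (nonempty, unoriented) link diagram. -/
structure LinkDiagram : Type where
  word : List Slice
  closed : IsTangle word 0 0
  nonempty : word ≠ []

/-- The crossingless diagram of the unknot. -/
def unknot : LinkDiagram where
  word := [maxAt 0, minAt 0]
  closed := by simp [IsTangle, SliceKind.inputs, SliceKind.outputs]
  nonempty := by simp

/-- The local moves that generate regular isotopy: planar isotopy (the first five moves) and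
the second and third Reidemeister moves. The first Reidemeister move is not among them. -/
inductive LocalMove : List Slice → List Slice → Prop
  | commute (k l : SliceKind) (i m : ℕ) :
      LocalMove [⟨k, i⟩, ⟨l, i + k.outputs + m⟩] [⟨l, i + k.inputs + m⟩, ⟨k, i⟩]
  | zigzagLeft (i : ℕ) : LocalMove [maxAt i, minAt (i + 1)] []
  | zigzagRight (i : ℕ) : LocalMove [maxAt (i + 1), minAt i] []
  | slideMax (s : ℤˣ) (i : ℕ) :
      LocalMove [maxAt (i + 1), crossAt s i] [maxAt i, crossAt (-s) (i + 1)]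
  | slideMin (s : ℤˣ) (i : ℕ) :
      LocalMove [crossAt s i, minAt (i + 1)] [crossAt (-s) (i + 1), minAt i]
  | reidemeisterTwo (s : ℤˣ) (i : ℕ) : LocalMove [crossAt s i, crossAt (-s) i] []
  | reidemeisterThree (i : ℕ) :
      LocalMove [crossAt 1 i, crossAt 1 (i + 1), crossAt 1 i]
        [crossAt 1 (i + 1), crossAt 1 i, crossAt 1 (i + 1)]

/-- `D` and `D'` agree except that `D` contains `x` where `D'` contains `y`. -/
def DifferBy (D D' : LinkDiagram) (x y : List Slice) : Prop :=
  ∃ u v : List Slice, D.word = u ++ x ++ v ∧ D'.word = u ++ y ++ v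

/-- `D'` arises from `D` by one move of a regular isotopy. -/
def RegularMove (D D' : LinkDiagram) : Prop :=
  ∃ x y : List Slice, LocalMove x y ∧ DifferBy D D' x y

/-- The four diagrams `L₊`, `L₋`, `L_a`, `L_b`, which differ only at one crossing. -/
def SkeinQuadruple (Lp Lm La Lb : LinkDiagram) : Prop :=
  ∃ (u v : List Slice) (i : ℕ),
    Lp.word = u ++ [crossAt 1 i] ++ v ∧ Lm.word = u ++ [crossAt (-1) i] ++ v ∧
    La.word = u ++ v ∧ Lb.word = u ++ [minAt i, maxAt i] ++ v

/-- `D'` is `D` with a kink of sign `s` inserted in a strand, on the right or on the left. -/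
def HasKink (s : ℤˣ) (D D' : LinkDiagram) : Prop :=
  ∃ i : ℕ, DifferBy D D' [] [maxAt (i + 1), crossAt s i, minAt (i + 1)] ∨
    DifferBy D D' [] [maxAt i, crossAt s (i + 1), minAt i]

/-- `D'` is the disjoint union of `D` and a crossingless circle that bounds a disc disjoint
from `D`. -/
def AddsCircle (D D' : LinkDiagram) : Prop :=
  ∃ i : ℕ, DifferBy D D' [] [maxAt i, minAt i]

/-! ### The Kauffman polynomial -/

/-- The ring `ℤ[a, a⁻¹, z, z⁻¹]`. -/
def AZ : Type := LaurentPolynomial (LaurentPolynomial ℤ)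

noncomputable instance : CommRing AZ :=
  inferInstanceAs (CommRing (LaurentPolynomial (LaurentPolynomial ℤ)))

/-- The monomial `a ^ n`. -/
noncomputable def aPow (n : ℤ) : AZ :=
  (LaurentPolynomial.C (LaurentPolynomial.T n) : LaurentPolynomial (LaurentPolynomial ℤ))

/-- The monomial `z ^ n`. -/
noncomputable def zPow (n : ℤ) : AZ :=
  (LaurentPolynomial.T n : LaurentPolynomial (LaurentPolynomial ℤ))

/-- The factor `(a + a⁻¹) / z - 1` of a disjoint circle. -/
noncomputable def circleValue : AZ := (aPow 1 + aPow (-1)) * zPow (-1) - 1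

/-- The defining properties of the polynomial `K` of unoriented link diagrams: it is an
invariant of regular isotopy, it satisfies the skein relation `K(L₊) + K(L₋) = z (K(L_a) + K(L_b))`,
a positive (negative) kink contributes the factor `a⁻¹` (`a`), a disjoint circle
the factor `(a + a⁻¹) / z - 1`, and the unknot has the value `1`. -/
structure IsKauffmanPolynomial (K : LinkDiagram → AZ) : Prop where
  regular : ∀ D D', RegularMove D D' → K D = K D'
  skein : ∀ Lp Lm La Lb, SkeinQuadruple Lp Lm La Lb → K Lp + K Lm = zPow 1 * (K La + K Lb)
  kink : ∀ (s : ℤˣ) (D D'), HasKink s D D' → K D' = aPow (-(s : ℤ)) * K D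
  circle : ∀ D D', AddsCircle D D' → K D' = circleValue * K D
  unknot : K unknot = 1

/-- The same relations in the free module on all link diagrams. -/
inductive SkeinRelation : (LinkDiagram →₀ AZ) → Prop
  | regular (D D' : LinkDiagram) (h : RegularMove D D') :
      SkeinRelation (Finsupp.single D 1 - Finsupp.single D' 1)
  | skein (Lp Lm La Lb : LinkDiagram) (h : SkeinQuadruple Lp Lm La Lb) :
      SkeinRelation (Finsupp.single Lp 1 + Finsupp.single Lm 1 -
        (Finsupp.single La (zPow 1) + Finsupp.single Lb (zPow 1)))
  | kink (s : ℤˣ) (D D' : LinkDiagram) (h : HasKink s D D') :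
      SkeinRelation (Finsupp.single D' 1 - Finsupp.single D (aPow (-(s : ℤ))))
  | circle (D D' : LinkDiagram) (h : AddsCircle D D') :
      SkeinRelation (Finsupp.single D' 1 - Finsupp.single D circleValue)

/-- The Kauffman skein module of the plane: the universal target of `K`, without the
normalization at the unknot. -/
abbrev SkeinModule : Type :=
  (LinkDiagram →₀ AZ) ⧸ Submodule.span AZ {x : LinkDiagram →₀ AZ | SkeinRelation x}

/-- The class of a link diagram in the skein module. -/
noncomputable def skeinClass (D : LinkDiagram) : SkeinModule :=
  Submodule.Quotient.mk (Finsupp.single D 1)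

/-! ### Torus links -/

/-- The closure, on the right, of the braid `σ₁ ^ (s * q)` on two strands. -/
def torusWord (s : ℤˣ) (q : ℕ) : List Slice :=
  [maxAt 0, maxAt 1] ++ List.replicate q (crossAt s 0) ++ [minAt 1, minAt 0]

theorem isTangle_torusWord (s : ℤˣ) (q : ℕ) : IsTangle (torusWord s q) 0 0 := by
  have h : IsTangle (List.replicate q (crossAt s 0) ++ [minAt 1, minAt 0]) 4 0 := by
    induction q with
    | zero => simp [IsTangle, SliceKind.inputs, SliceKind.outputs]
    | succ n ih =>
      rw [List.replicate_succ]
      exact ⟨by simp [SliceKind.inputs], ih⟩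
  exact ⟨by simp [SliceKind.inputs], by simp [SliceKind.inputs, SliceKind.outputs], h⟩

/-- The standard diagram of the `(2, q)` torus link (`s = 1`) or of its mirror image
(`s = -1`). -/
def torusLink (s : ℤˣ) (q : ℕ) : LinkDiagram where
  word := torusWord s q
  closed := isTangle_torusWord s q
  nonempty := by simp [torusWord]

/-! ### The balanced overlaid Tait graph -/

/-- The number of strands of a link diagram below its first `t` slices. -/
def strandsAt (w : List Slice) (t : ℕ) : ℕ :=
  (w.take t).foldl (fun n s => n - s.kind.inputs + s.kind.outputs) 0

/-- A gap `(t, g)` is the interval with exactly `g` strands to its left on the horizontal line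
below the first `t` slices. -/
abbrev Gap (w : List Slice) : Type :=
  {p : ℕ × ℕ // p.1 ≤ w.length ∧ p.2 ≤ strandsAt w p.1}

/-- Two gaps above and below one slice belong to the same face if they are joined on the left
or on the right of the maximum, minimum or crossing in that slice. -/
def GapAdj (w : List Slice) (x y : Gap w) : Prop :=
  y.1.1 = x.1.1 + 1 ∧ ∃ s : Slice, w[x.1.1]? = some s ∧
    ((x.1.2 ≤ s.pos ∧ y.1.2 = x.1.2) ∨
      ∃ r : ℕ, x.1.2 = s.pos + s.kind.inputs + r ∧ y.1.2 = s.pos + s.kind.outputs + r)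

/-- The faces of a link diagram (for disconnected diagrams as well), including the outside. -/
def Face (w : List Slice) : Type := Quot (GapAdj w)

/-- The face containing a gap. -/
def faceOf (w : List Slice) (x : Gap w) : Face w := Quot.mk _ x

/-- The checkerboard colouring in which the outside face is not shaded: a face is shaded if an
odd number of strands stands to the left of its gaps. -/
def Face.Shaded {w : List Slice} : Face w → Prop :=
  Quot.lift (fun x => Odd x.1.2) (by
    rintro x y ⟨-, s, -, ⟨-, h⟩ | ⟨r, h1, h2⟩⟩
    · simp [h]
    · rcases s with ⟨k, i⟩
      cases k <;> simp [SliceKind.inputs, SliceKind.outputs] at h1 h2 <;>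
        rw [h1, h2] <;> apply propext <;> simp only [Nat.odd_iff] <;> omega)

/-- The crossings, given by the indices of their slices and ordered from top to bottom. -/
abbrev Crossing (w : List Slice) : Type :=
  {t : ℕ // ∃ (s : ℤˣ) (i : ℕ), w[t]? = some (crossAt s i)}

/-- A crossing touches the faces on its left and right, above it and below it. -/
def Touches (w : List Slice) (v : Crossing w) (f : Face w) : Prop :=
  ∃ (s : ℤˣ) (i : ℕ), w[v.1]? = some (crossAt s i) ∧ ∃ x : Gap w, faceOf w x = f ∧
    (x.1 = (v.1, i) ∨ x.1 = (v.1, i + 2) ∨ x.1 = (v.1, i + 1) ∨ x.1 = (v.1 + 1, i + 1))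

/-- The sign of a crossing with respect to the checkerboard colouring: a crossing `σ` is
positive if the faces above and below it are shaded, and negative if those on its left and right
are shaded; for `σ⁻¹` it is the other way round. -/
def IsPositiveCrossing (w : List Slice) (v : Crossing w) : Prop :=
  ∃ (s : ℤˣ) (i : ℕ), w[v.1]? = some (crossAt s i) ∧ (s = 1 ↔ Even i)

/-- The activity letters `L, ℓ, D, d` and their barred versions. -/
inductive ActivityLetter : Type
  | L | ell | D | d | Lbar | ellbar | Dbar | dbar

/-- The vertices of the balanced overlaid Tait graph other than the crossings: all faces except
the two omitted ones. -/
abbrev RemainingFace (w : List Slice) (f₂ f₃ : Face w) : Type :=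
  {f : Face w // f ≠ f₂ ∧ f ≠ f₃}

/-- `v` is the lowest vertex, in the order of the crossings, among those adjacent to `f`. -/
def IsLowest (w : List Slice) (v : Crossing w) (f : Face w) : Prop :=
  Touches w v f ∧ ∀ v' : Crossing w, Touches w v' f → v.1 ≤ v'.1

open Classical in
/-- The activity letter of the edge from the crossing `v` to the face `f`. -/
noncomputable def edgeLetter (w : List Slice) (v : Crossing w) (f : Face w) : ActivityLetter :=
  if IsPositiveCrossing w v then
    if f.Shaded then (if IsLowest w v f then .L else .D)
    else (if IsLowest w v f then .ell else .d)
  else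
    if f.Shaded then (if IsLowest w v f then .Lbar else .Dbar)
    else (if IsLowest w v f then .ellbar else .dbar)

/-- A perfect matching of the balanced overlaid Tait graph, as a set of edges such that every
vertex is incident to exactly one of them. -/
def IsPerfectMatching (w : List Slice) (f₂ f₃ : Face w)
    (M : Finset (Crossing w × RemainingFace w f₂ f₃)) : Prop :=
  (∀ e ∈ M, Touches w e.1 e.2.1) ∧ (∀ v, ∃! f, (v, f) ∈ M) ∧ (∀ f, ∃! v, (v, f) ∈ M)

instance (w : List Slice) : Finite (Gap w) := by
  refine Set.Finite.to_subtype (Set.Finite.subset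
    (Set.finite_Iic (w.length, (Finset.range (w.length + 1)).sup (strandsAt w))) ?_)
  rintro ⟨t, g⟩ ⟨h1, h2⟩
  exact ⟨h1, le_trans h2 (Finset.le_sup (f := strandsAt w)
    (Finset.mem_range.2 (Nat.lt_succ_of_le h1)))⟩

instance (w : List Slice) : Finite (Face w) :=
  inferInstanceAs (Finite (Quot (GapAdj w)))

instance (w : List Slice) : Finite (Crossing w) := by
  refine Set.Finite.to_subtype (Set.Finite.subset (Set.finite_Iio w.length) ?_)
  rintro t ⟨s, i, h⟩
  exact (List.getElem?_eq_some_iff.1 h).1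

noncomputable instance (w : List Slice) (f₂ f₃ : Face w) :
    Fintype (Crossing w × RemainingFace w f₂ f₃) := Fintype.ofFinite _

open Classical in
/-- The sum of the activity words of all perfect matchings of the balanced overlaid Tait graph
from which the faces `f₂` and `f₃` are omitted. -/
noncomputable def activityPolynomial (w : List Slice) (f₂ f₃ : Face w) :
    MvPolynomial ActivityLetter ℤ :=
  ∑ M ∈ Finset.univ.filter (IsPerfectMatching w f₂ f₃),
    ∏ e ∈ M, MvPolynomial.X (edgeLetter w e.1 e.2.1)

/-- A face of the diagram of the `(2, q)` torus link just above the braid. Of these, the outside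
face is the one with `g = 0` or `g = 4`. -/
def torusFace (q g : ℕ) (hg : g ≤ 4) : Face (torusWord 1 q) :=
  faceOf _ ⟨(2, g), by simp [torusWord], by
    simpa [torusWord, strandsAt, SliceKind.inputs, SliceKind.outputs] using hg⟩

/-- The polynomial `P_q` of the `(2, q)` torus link. The two omitted faces, one shaded and one
not, are the first two from the right other than the outside face. -/
noncomputable def torusP (q : ℕ) : MvPolynomial ActivityLetter ℤ :=
  activityPolynomial (torusWord 1 q) (torusFace q 3 (by norm_num)) (torusFace q 2 (by norm_num))

/-- The specialization `L = a ^ n`, `ℓ = a ^ (-n)`, `D = d = z`, with the barred letters (which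
do not occur in `P_q`) specialized as for the mirror image. -/
noncomputable def specialize (n : ℤ) : ActivityLetter → AZ
  | .L => aPow n
  | .ell => aPow (-n)
  | .D => zPow 1
  | .d => zPow 1
  | .Lbar => aPow (-n)
  | .ellbar => aPow n
  | .Dbar => zPow 1
  | .dbar => zPow 1

end Knot

namespace Knot

/-! ### Regular isotopy and skein relations for words -/

/-! Both sides satisfy the same first-order recursion in `q`. Apply the skein relation to the last
crossing of T(2, n+2), with all crossings of sign s. Switching this crossing cancels it against its
neighbour by a second Reidemeister move, which gives T(2, n). One smoothing gives T(2, n+1). The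
other caps the remaining n+1 crossings by a minimum, so that they unwind as kinks to a^(s(n+1))
K(O). Hence K(n+2) = z K(n+1) + z a^(s(n+1)) K(O) - K(n) (`torusLink_add_two`). The term -K(n)
builds up the subtracted sum, and what is left is a recursion that P_q has to satisfy
(`torusLink_eq`). The value of a disjoint circle is never needed, because K(2,0) stays in the sum.
Thus one argument for maps into an arbitrary module (`IsSkeinInvariant`) serves both the polynomial
and the skein module.

On the combinatorial side, the balanced overlaid Tait graph is a fan: every crossing touches the
outside face, and consecutive crossings share a bigon. A perfect matching is determined by the
crossing i matched to the outside: crossings above i must take the bigon below them, and those below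
i the bigon above them (`eq_fanMatching`). Their letters are L and D respectively, and crossing i
has ℓ or d. Reading off the last crossing gives P_(n+2) = P_(n+1) D + d L^(n+1) (`torusP_add_two`),
which specializes to the required recursion. -/

theorem IsTangle.braid_append_iff (s : ℤˣ) (n : ℕ) (v : List Slice) :
    IsTangle ([maxAt 0, maxAt 1] ++ List.replicate n (crossAt s 0) ++ v) 0 0 ↔
      IsTangle v 4 0 := by
  have h : IsTangle (List.replicate n (crossAt s 0) ++ v) 4 0 ↔ IsTangle v 4 0 := by
    induction n with
    | zero => simp
    | succ n ih =>
      rw [List.replicate_succ, List.cons_append, IsTangle]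
      simpa [SliceKind.inputs, SliceKind.outputs] using ih
  simpa [IsTangle, SliceKind.inputs, SliceKind.outputs] using h

/-- The diagram with two nested maxima, the braid `σ₁ ^ (s * n)` on the first two of the four
strands, and the tangle `v` below it. -/
def braidDiagram (s : ℤˣ) (n : ℕ) (v : List Slice) (hv : IsTangle v 4 0) : LinkDiagram where
  word := [maxAt 0, maxAt 1] ++ List.replicate n (crossAt s 0) ++ v
  closed := (IsTangle.braid_append_iff s n v).2 hv
  nonempty := by simp

theorem braidDiagram_cons (s : ℤˣ) (n : ℕ) (v : List Slice) (hv : IsTangle v 4 0)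
    (hv' : IsTangle (crossAt s 0 :: v) 4 0) :
    braidDiagram s n (crossAt s 0 :: v) hv' = braidDiagram s (n + 1) v hv := by
  simp [braidDiagram, List.replicate_succ']

/-- The relations of the Kauffman polynomial needed for the links `T(2, q)`, for a map with values
in any module. -/
structure IsSkeinInvariant {M : Type*} [AddCommGroup M] [Module AZ M] (K : LinkDiagram → M) :
    Prop where
  regular : ∀ D D', RegularMove D D' → K D = K D'
  skein : ∀ Lp Lm La Lb, SkeinQuadruple Lp Lm La Lb → K Lp + K Lm = zPow 1 • (K La + K Lb)
  kink : ∀ (s : ℤˣ) (D D'), HasKink s D D' → K D' = aPow (-(s : ℤ)) • K D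

theorem IsKauffmanPolynomial.isSkeinInvariant {K : LinkDiagram → AZ}
    (hK : IsKauffmanPolynomial K) : IsSkeinInvariant K :=
  ⟨hK.regular, hK.skein, hK.kink⟩

theorem skeinClass_isSkeinInvariant : IsSkeinInvariant skeinClass where
  regular D D' h :=
    (Submodule.Quotient.eq _).2 (Submodule.subset_span (SkeinRelation.regular D D' h))
  skein Lp Lm La Lb h := by
    have h1 := (Submodule.Quotient.eq (Submodule.span AZ {x | SkeinRelation x})).2
      (Submodule.subset_span (SkeinRelation.skein Lp Lm La Lb h))
    simp only [skeinClass]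
    rw [← Submodule.Quotient.mk_add, ← Submodule.Quotient.mk_add, ← Submodule.Quotient.mk_smul, h1,
      smul_add, Finsupp.smul_single, Finsupp.smul_single, smul_eq_mul, mul_one]
  kink s D D' h := by
    have h1 := (Submodule.Quotient.eq (Submodule.span AZ {x | SkeinRelation x})).2
      (Submodule.subset_span (SkeinRelation.kink s D D' h))
    simp only [skeinClass]
    rw [← Submodule.Quotient.mk_smul, h1, Finsupp.smul_single, smul_eq_mul, mul_one]

theorem aPow_add (m n : ℤ) : aPow (m + n) = aPow m * aPow n := by
  simp only [aPow, LaurentPolynomial.T_add, map_mul]; rfl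

theorem aPow_zero : aPow 0 = 1 := by
  simp only [aPow, LaurentPolynomial.T_zero, map_one]; rfl

theorem zPow_add (m n : ℤ) : zPow (m + n) = zPow m * zPow n :=
  LaurentPolynomial.T_add m n

theorem zPow_zero : zPow 0 = 1 := LaurentPolynomial.T_zero

/-! ### The three-term recursion for closures of two-strand braids. -/

namespace IsSkeinInvariant

variable {M : Type*} [AddCommGroup M] [Module AZ M] {K : LinkDiagram → M}

theorem braid_move (hK : IsSkeinInvariant K) {x y : List Slice} (h : LocalMove x y) (s : ℤˣ)
    (n : ℕ) (u v : List Slice) (hx : IsTangle (u ++ x ++ v) 4 0)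
    (hy : IsTangle (u ++ y ++ v) 4 0) :
    K (braidDiagram s n (u ++ x ++ v) hx) = K (braidDiagram s n (u ++ y ++ v) hy) :=
  hK.regular _ _ ⟨x, y, h, [maxAt 0, maxAt 1] ++ List.replicate n (crossAt s 0) ++ u, v,
    by simp [braidDiagram], by simp [braidDiagram]⟩

theorem isTangle_min_min : IsTangle [minAt 0, minAt 0] 4 0 := by
  simp [IsTangle, SliceKind.inputs, SliceKind.outputs]

theorem isTangle_closure : IsTangle [minAt 1, minAt 0] 4 0 := by
  simp [IsTangle, SliceKind.inputs, SliceKind.outputs]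

/-- A crossing followed by a minimum joining its two strands is a kink. -/
theorem cross_min (hK : IsSkeinInvariant K) (s : ℤˣ) (n : ℕ) :
    K (braidDiagram s (n + 1) [minAt 0, minAt 0] isTangle_min_min) =
      aPow (s : ℤ) • K (braidDiagram s n [minAt 0, minAt 0] isTangle_min_min) := by
  have h1 : IsTangle [maxAt 0, crossAt (-s) 1, minAt 0, minAt 0, minAt 0] 4 0 := by
    simp [IsTangle, SliceKind.inputs, SliceKind.outputs]
  have h2 : IsTangle [maxAt 0, crossAt (-s) 1, minAt 2, minAt 0, minAt 0] 4 0 := by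
    simp [IsTangle, SliceKind.inputs, SliceKind.outputs]
  have h3 : IsTangle [maxAt 0, crossAt s 2, minAt 1, minAt 0, minAt 0] 4 0 := by
    simp [IsTangle, SliceKind.inputs, SliceKind.outputs]
  have h4 : IsTangle [crossAt s 0, maxAt 0, minAt 1, minAt 0, minAt 0] 4 0 := by
    simp [IsTangle, SliceKind.inputs, SliceKind.outputs]
  have h5 : IsTangle [crossAt s 0, minAt 0, minAt 0] 4 0 := by
    simp [IsTangle, SliceKind.inputs, SliceKind.outputs]
  -- The kink is created on the left of the leftmost strand. Exchanging two minima, sliding the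
  -- crossing past a minimum (which turns `-s` into `s`), and straightening the strand turn it into
  -- a crossing `s` above the minimum. This is why the kink has sign `-s` and the factor is `a ^ s`.
  have e0 := hK.kink (-s) (braidDiagram s n [minAt 0, minAt 0] isTangle_min_min)
    (braidDiagram s n _ h1) ⟨0, Or.inr ⟨[maxAt 0, maxAt 1] ++ List.replicate n (crossAt s 0),
      [minAt 0, minAt 0], by simp [braidDiagram], by simp [braidDiagram]⟩⟩
  have e1 := hK.braid_move (LocalMove.commute .min .min 0 0) s n [maxAt 0, crossAt (-s) 1]
    [minAt 0] h1 h2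
  have e2 := hK.braid_move (LocalMove.slideMin (-s) 1) s n [maxAt 0] [minAt 0, minAt 0] h2
    (by simpa using h3)
  have e3 := hK.braid_move (LocalMove.commute .max (.crossing s) 0 0) s n []
    [minAt 1, minAt 0, minAt 0] h3 h4
  have e4 := hK.braid_move (LocalMove.zigzagLeft 0) s n [crossAt s 0] [minAt 0, minAt 0] h4 h5
  have e5 := congrArg K (braidDiagram_cons s n _ isTangle_min_min h5)
  simp only [neg_neg, Units.val_neg] at e0 e2
  exact e5.symm.trans (e4.symm.trans (e3.symm.trans (e2.symm.trans (e1.symm.trans e0))))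

theorem braid_min_min (hK : IsSkeinInvariant K) (s : ℤˣ) (n : ℕ) :
    K (braidDiagram s n [minAt 0, minAt 0] isTangle_min_min) =
      aPow ((s : ℤ) * n) • K unknot := by
  induction n with
  | zero =>
    have h := hK.regular (braidDiagram s 0 [minAt 0, minAt 0] isTangle_min_min) unknot
      ⟨_, _, LocalMove.zigzagRight 0, [maxAt 0], [minAt 0], rfl, rfl⟩
    simp [h, aPow_zero]
  | succ n ih =>
    rw [hK.cross_min, ih, smul_smul, ← aPow_add]
    congr 2
    push_cast; ring

theorem torusLink_one (hK : IsSkeinInvariant K) (s : ℤˣ) :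
    K (torusLink s 1) = aPow (-(s : ℤ)) • K unknot :=
  hK.kink s _ _ ⟨0, Or.inl ⟨[maxAt 0], [minAt 0], rfl, rfl⟩⟩

theorem torusLink_add_two (hK : IsSkeinInvariant K) (s : ℤˣ) (n : ℕ) :
    K (torusLink s (n + 2)) + K (torusLink s n) =
      zPow 1 • (K (torusLink s (n + 1)) + aPow ((s : ℤ) * (n + 1 : ℕ)) • K unknot) := by
  have hp (t : ℤˣ) : IsTangle [crossAt t 0, minAt 1, minAt 0] 4 0 := by
    simp [IsTangle, SliceKind.inputs, SliceKind.outputs]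
  have hb : IsTangle [minAt 0, maxAt 0, minAt 1, minAt 0] 4 0 := by
    simp [IsTangle, SliceKind.inputs, SliceKind.outputs]
  have hm : IsTangle [crossAt s 0, crossAt (-s) 0, minAt 1, minAt 0] 4 0 := by
    simp [IsTangle, SliceKind.inputs, SliceKind.outputs]
  have e1 : braidDiagram s (n + 1) _ (hp s) = torusLink s (n + 2) :=
    braidDiagram_cons s (n + 1) _ isTangle_closure (hp s)
  -- The switched crossing cancels against the last of the `n + 1` crossings above it, so that `n`
  -- remain.
  have e2 : K (braidDiagram s (n + 1) _ (hp (-s))) = K (torusLink s n) := by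
    rw [← braidDiagram_cons s n _ (hp (-s)) hm]
    exact hK.braid_move (LocalMove.reidemeisterTwo s 0) s n [] [minAt 1, minAt 0] hm
      isTangle_closure
  have e3 := hK.braid_move (LocalMove.zigzagLeft 0) s (n + 1) [minAt 0] [minAt 0] hb
    isTangle_min_min
  have e4 := hK.skein (braidDiagram s (n + 1) _ (hp 1)) (braidDiagram s (n + 1) _ (hp (-1)))
    (torusLink s (n + 1)) (braidDiagram s (n + 1) _ hb)
    ⟨[maxAt 0, maxAt 1] ++ List.replicate (n + 1) (crossAt s 0), [minAt 1, minAt 0], 0,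
      by simp [braidDiagram], by simp [braidDiagram], by simp [torusLink, torusWord],
      by simp [braidDiagram]⟩
  have e5 := e3.trans (hK.braid_min_min s (n + 1))
  simp only [List.cons_append, List.nil_append] at e5
  rw [e5] at e4
  rw [← e4, ← e1, ← e2]
  -- The skein quadruple lists `σ` before `σ⁻¹`; for `s = -1` the two summands change places.
  obtain rfl | rfl := Int.units_eq_one_or s
  · rfl
  · simp only [neg_neg]
    exact add_comm _ _

/-- If `P` satisfies the recursion of the activity polynomials, then `K (T(2, q))` is
`P q` minus a combination of the preceding `K (T(2, i))`. -/
theorem torusLink_eq (hK : IsSkeinInvariant K) (s : ℤˣ) (P : ℕ → AZ)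
    (h1 : P 1 = aPow (-(s : ℤ)))
    (hP : ∀ n, P (n + 2) = P (n + 1) * zPow 1 + zPow 1 * aPow ((s : ℤ) * (n + 1 : ℕ))) (n : ℕ) :
    K (torusLink s (n + 1)) = P (n + 1) • K unknot -
      ∑ i ∈ Finset.range n, zPow ((n : ℤ) - 1 - i) • K (torusLink s i) := by
  induction n with
  | zero => simp [hK.torusLink_one, h1]
  | succ n ih =>
    have h2 : ∑ i ∈ Finset.range n, zPow (((n + 1 : ℕ) : ℤ) - 1 - i) • K (torusLink s i) =
        zPow 1 • ∑ i ∈ Finset.range n, zPow ((n : ℤ) - 1 - i) • K (torusLink s i) := by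
      rw [Finset.smul_sum]
      refine Finset.sum_congr rfl fun i _ => ?_
      rw [smul_smul, ← zPow_add]
      congr 2
      push_cast; ring
    -- The new summand `i = n` has coefficient `z ^ 0`; it is the term `-K (T(2, n))` of the
    -- three-term recursion.
    have h3 : zPow (((n + 1 : ℕ) : ℤ) - 1 - n) = 1 := by
      rw [← zPow_zero]
      congr 1
      push_cast; ring
    rw [Finset.sum_range_succ, h2, h3, one_smul, eq_sub_of_add_eq (hK.torusLink_add_two s n), hP,
      ih]
    module

end IsSkeinInvariant

/-! ### Perfect matchings of a fan -/

/-- In the bipartite graph in which `k` is adjacent to `0`, `k` and `k + 1`, the perfect matching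
that contains the edge from `i` to `0`. -/
def fanMatching {q : ℕ} (i k : Fin q) : Fin q :=
  ⟨if k.1 < i.1 then k.1 + 1 else if k = i then 0 else k.1, by
    have := i.2; have := k.2; split_ifs <;> omega⟩

theorem fanMatching_val {q : ℕ} (i k : Fin q) :
    (fanMatching i k).1 = if k.1 < i.1 then k.1 + 1 else if k.1 = i.1 then 0 else k.1 := by
  simp [fanMatching, Fin.ext_iff]

theorem fanMatching_adj {q : ℕ} (i k : Fin q) :
    (fanMatching i k).1 = 0 ∨ (fanMatching i k).1 = k.1 ∨ (fanMatching i k).1 = k.1 + 1 := by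
  rw [fanMatching_val]; split_ifs <;> simp

theorem fanMatching_injective {q : ℕ} (i : Fin q) : Function.Injective (fanMatching i) := by
  intro k l h
  have h := congrArg Fin.val h
  simp only [fanMatching_val] at h
  ext
  split_ifs at h <;> omega

theorem fanMatching_left_injective {q : ℕ} {i j : Fin q} (h : fanMatching i = fanMatching j) :
    i = j := by
  have h := congrArg Fin.val (congrFun h i)
  simp only [fanMatching_val] at h
  ext
  split_ifs at h <;> omega

/-- Everything is forced from both ends. Above `i`, the values `0` and `n` are already taken by `i`
and `n - 1`, which leaves `n + 1`. Below `i`, the last index cannot take `q`, which is out of range,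
and each earlier one finds its upper neighbour taken. -/
theorem eq_fanMatching {q : ℕ} {f : Fin q → Fin q} (hf : Function.Injective f)
    (hadj : ∀ k, (f k).1 = 0 ∨ (f k).1 = k.1 ∨ (f k).1 = k.1 + 1) {i : Fin q}
    (hi : (f i).1 = 0) : f = fanMatching i := by
  have hne {k l : Fin q} (h : k.1 ≠ l.1) : (f k).1 ≠ (f l).1 := fun e =>
    h (congrArg Fin.val (hf (Fin.ext e)))
  have hlow : ∀ n (hn : n < q), n < i.1 → (f ⟨n, hn⟩).1 = n + 1 := by
    intro n
    induction n with
    | zero =>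
      intro hn h
      have h1 := hadj ⟨0, hn⟩
      have h2 := hne (k := ⟨0, hn⟩) (l := i) (by simp only; omega)
      simp only at h1
      omega
    | succ n ih =>
      intro hn h
      have h1 := hadj ⟨n + 1, hn⟩
      have h2 := hne (k := ⟨n + 1, hn⟩) (l := i) (by simp only; omega)
      have h3 := hne (k := ⟨n + 1, hn⟩) (l := ⟨n, by omega⟩) (by simp)
      have h4 := ih (by omega) (by omega)
      simp only at h1
      omega
  -- Downward induction; `n` is the distance from the last index `q - 1`.
  have hhigh : ∀ n (hn : n < q), i.1 < q - 1 - n → (f ⟨q - 1 - n, by omega⟩).1 = q - 1 - n := by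
    intro n
    induction n with
    | zero =>
      intro hn h
      have h1 := hadj ⟨q - 1 - 0, by omega⟩
      have h2 := hne (k := ⟨q - 1 - 0, by omega⟩) (l := i) (by simp only; omega)
      have h3 := (f ⟨q - 1 - 0, by omega⟩).2
      simp only at h1
      omega
    | succ n ih =>
      intro hn h
      have h1 := hadj ⟨q - 1 - (n + 1), by omega⟩
      have h2 := hne (k := ⟨q - 1 - (n + 1), by omega⟩) (l := i) (by simp only; omega)
      have h3 := hne (k := ⟨q - 1 - (n + 1), by omega⟩) (l := ⟨q - 1 - n, by omega⟩)
        (by simp only; omega)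
      have h4 := ih (by omega) (by omega)
      simp only at h1
      omega
  funext k
  ext
  rw [fanMatching_val]
  split_ifs with h1 h2
  · exact hlow k k.2 h1
  · rw [show k = i from Fin.ext h2, hi]
  · have h3 := hhigh (q - 1 - k.1) (by omega) (by omega)
    have h4 : (⟨q - 1 - (q - 1 - k.1), by omega⟩ : Fin q) = k := Fin.ext (by simp only; omega)
    rw [h4] at h3
    omega

/-- Through the two numberings a perfect matching becomes an injective self-map of `Fin q`. By
finiteness it takes the value `0` at some `i`, and `eq_fanMatching` then identifies it. -/
theorem activityPolynomial_eq_sum_fanMatching {w : List Slice} {f₂ f₃ : Face w} {q : ℕ}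
    (hq : 0 < q) (eC : Fin q ≃ Crossing w) (eF : Fin q ≃ RemainingFace w f₂ f₃)
    (htouch : ∀ k j, Touches w (eC k) (eF j).1 ↔ j.1 = 0 ∨ j.1 = k.1 ∨ j.1 = k.1 + 1) :
    activityPolynomial w f₂ f₃ =
      ∑ i : Fin q, ∏ k : Fin q,
        MvPolynomial.X (edgeLetter w (eC k) (eF (fanMatching i k)).1) := by
  classical
  have hinj (i : Fin q) : Function.Injective fun k => (eC k, eF (fanMatching i k)) :=
    fun k l h => eC.injective (congrArg Prod.fst h)
  let edges (i : Fin q) : Finset (Crossing w × RemainingFace w f₂ f₃) :=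
    Finset.univ.image fun k => (eC k, eF (fanMatching i k))
  have hmem (i k j : Fin q) : (eC k, eF j) ∈ edges i ↔ j = fanMatching i k := by
    simp only [edges, Finset.mem_image, Finset.mem_univ, true_and, Prod.mk.injEq]
    constructor
    · rintro ⟨l, h1, h2⟩
      rw [← eF.injective h2, eC.injective h1]
    · rintro rfl
      exact ⟨k, rfl, rfl⟩
  rw [activityPolynomial]
  symm
  refine Finset.sum_bij (fun i _ => edges i) ?_ ?_ ?_ ?_
  · intro i _
    refine Finset.mem_filter.2 ⟨Finset.mem_univ _, ?_, ?_, ?_⟩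
    · intro e he
      obtain ⟨k, -, rfl⟩ := Finset.mem_image.1 he
      exact (htouch _ _).2 (fanMatching_adj i k)
    · intro v
      obtain ⟨k, rfl⟩ := eC.surjective v
      refine ⟨eF (fanMatching i k), (hmem _ _ _).2 rfl, fun f hf => ?_⟩
      obtain ⟨j, rfl⟩ := eF.surjective f
      rw [(hmem _ _ _).1 hf]
    · intro f
      obtain ⟨j, rfl⟩ := eF.surjective f
      obtain ⟨k, rfl⟩ := (Finite.injective_iff_surjective.1 (fanMatching_injective i)) j
      refine ⟨eC k, (hmem _ _ _).2 rfl, fun v hv => ?_⟩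
      obtain ⟨l, rfl⟩ := eC.surjective v
      rw [fanMatching_injective i ((hmem _ _ _).1 hv)]
  · intro i _ j _ h
    refine fanMatching_left_injective (funext fun k => ?_)
    rw [← hmem j, ← show edges i = edges j from h, hmem]
  · intro M hM
    obtain ⟨h1, h2, h3⟩ := (Finset.mem_filter.1 hM).2
    choose g hg hg' using h2
    have hf : Function.Injective fun k => eF.symm (g (eC k)) := fun k l h =>
      eC.injective ((h3 (g (eC k))).unique (hg _) (by
        rw [eF.symm.injective h]; exact hg _))
    obtain ⟨i, hi⟩ := Finite.injective_iff_surjective.1 hf ⟨0, hq⟩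
    have h4 := eq_fanMatching hf (fun k => (htouch k _).1 (by
      rw [eF.apply_symm_apply]; exact h1 _ (hg (eC k)))) (congrArg Fin.val hi)
    refine ⟨i, Finset.mem_univ _, ?_⟩
    ext ⟨v, f⟩
    obtain ⟨k, rfl⟩ := eC.surjective v
    obtain ⟨j, rfl⟩ := eF.surjective f
    rw [hmem, ← congrFun h4 k, Equiv.eq_symm_apply]
    exact ⟨fun h => h ▸ hg _, fun h => hg' _ _ h⟩
  · intro i _
    rw [Finset.prod_image fun k _ l _ h => hinj i h]

/-! ### The faces of the torus link diagram -/

theorem torusWord_length (s : ℤˣ) (q : ℕ) : (torusWord s q).length = q + 4 := by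
  simp [torusWord]

theorem torusWord_getElem?_crossing (s : ℤˣ) {q t : ℕ} (h1 : 2 ≤ t) (h2 : t < q + 2) :
    (torusWord s q)[t]? = some (crossAt s 0) := by
  obtain ⟨t, rfl⟩ := Nat.exists_eq_add_of_le' h1
  have h3 : t < q := by omega
  simp [torusWord, List.getElem?_append, h3]

theorem torusWord_getElem?_min_one (s : ℤˣ) (q : ℕ) :
    (torusWord s q)[q + 2]? = some (minAt 1) := by
  simp [torusWord]

theorem torusWord_getElem?_min_zero (s : ℤˣ) (q : ℕ) :
    (torusWord s q)[q + 3]? = some (minAt 0) := by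
  simp [torusWord]

theorem strandsAt_succ {w : List Slice} {t : ℕ} {s : Slice} (h : w[t]? = some s) :
    strandsAt w (t + 1) = strandsAt w t - s.kind.inputs + s.kind.outputs := by
  simp [strandsAt, List.take_add_one, h]

theorem strandsAt_torusWord_braid (s : ℤˣ) {q t : ℕ} (h : t ≤ q) :
    strandsAt (torusWord s q) (t + 2) = 4 := by
  induction t with
  | zero => simp [strandsAt, torusWord, SliceKind.inputs, SliceKind.outputs]
  | succ t ih =>
    rw [show t + 1 + 2 = (t + 2) + 1 by rfl,
      strandsAt_succ (torusWord_getElem?_crossing s (by omega) (by omega)), ih (by omega)]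
    simp [SliceKind.inputs, SliceKind.outputs]

theorem strandsAt_torusWord (s : ℤˣ) {q t : ℕ} (h : t ≤ q + 4) :
    strandsAt (torusWord s q) t =
      if t = 0 ∨ t = q + 4 then 0 else if t = 1 ∨ t = q + 3 then 2 else 4 := by
  have h3 : strandsAt (torusWord s q) (q + 3) = 2 := by
    rw [strandsAt_succ (torusWord_getElem?_min_one s q), strandsAt_torusWord_braid s le_rfl]
    simp [SliceKind.inputs, SliceKind.outputs]
  split_ifs with h1 h2
  · rcases h1 with rfl | rfl
    · simp [strandsAt]
    · rw [strandsAt_succ (torusWord_getElem?_min_zero s q), h3]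
      simp [SliceKind.inputs, SliceKind.outputs]
  · rcases h2 with rfl | rfl
    · simp [strandsAt, torusWord, SliceKind.inputs, SliceKind.outputs]
    · exact h3
  · obtain ⟨t, rfl⟩ := Nat.exists_eq_add_of_le' (show 2 ≤ t by omega)
    exact strandsAt_torusWord_braid s (by omega)

/-- The position `g` is a gap on level `t` of the diagram of `T(2, q)`. -/
def IsTorusGap (q t g : ℕ) : Prop :=
  t ≤ q + 4 ∧ g ≤ if t = 0 ∨ t = q + 4 then 0 else if t = 1 ∨ t = q + 3 then 2 else 4

theorem isTorusGap_iff {q t g : ℕ} :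
    IsTorusGap q t g ↔ t ≤ (torusWord 1 q).length ∧ g ≤ strandsAt (torusWord 1 q) t := by
  rw [IsTorusGap, torusWord_length]
  exact and_congr_right fun h => by rw [strandsAt_torusWord 1 h]

open Classical in
/-- The face containing the gap `(t, g)`, and the outside face if there is no such gap. -/
noncomputable def gapFace (q t g : ℕ) : Face (torusWord 1 q) :=
  if h : IsTorusGap q t g then faceOf _ ⟨(t, g), isTorusGap_iff.1 h⟩
  else faceOf _ ⟨(0, 0), by simp⟩

theorem faceOf_eq_gapFace {q : ℕ} (x : Gap (torusWord 1 q)) :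
    faceOf _ x = gapFace q x.1.1 x.1.2 := by
  rw [gapFace, dif_pos (isTorusGap_iff.2 x.2)]

theorem gapFace_eq_of_slice {q t g g' : ℕ} (h : IsTorusGap q t g) (h' : IsTorusGap q (t + 1) g')
    {s : Slice} (hs : (torusWord 1 q)[t]? = some s)
    (hg : (g ≤ s.pos ∧ g' = g) ∨
      ∃ r, g = s.pos + s.kind.inputs + r ∧ g' = s.pos + s.kind.outputs + r) :
    gapFace q t g = gapFace q (t + 1) g' := by
  rw [gapFace, gapFace, dif_pos h, dif_pos h']
  exact Quot.sound ⟨rfl, s, hs, hg⟩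

/-- The numbering of the faces of `T(2, q)`, as a function of a gap: `0` is the outside, `1`, …,
`q - 1` are the bigons of the braid, and `q` and `q + 1` are the omitted faces. -/
def gapLabel (q t g : ℕ) : ℕ :=
  if t ≤ 1 ∨ q + 3 ≤ t then (if g = 1 then q else 0)
  else if g = 1 then (if t = 2 then q else t - 2)
  else if g = 2 then q + 1
  else if g = 3 then q
  else 0

/-- A check for each kind of slice. It makes the numbering well defined on faces, so that gaps with
different labels lie in different faces. -/
theorem gapLabel_eq_of_gapAdj {q : ℕ} {x y : Gap (torusWord 1 q)}
    (h : GapAdj (torusWord 1 q) x y) :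
    gapLabel q x.1.1 x.1.2 = gapLabel q y.1.1 y.1.2 := by
  obtain ⟨⟨t, g⟩, hx⟩ := x
  obtain ⟨⟨t', g'⟩, hy⟩ := y
  obtain ⟨h1, s, hs, hg⟩ := h
  have hx := isTorusGap_iff.2 hx
  have hy := isTorusGap_iff.2 hy
  simp only at h1 hs hg ⊢
  subst h1
  have ht : t < q + 4 := by
    rw [← torusWord_length 1 q]
    exact (List.getElem?_eq_some_iff.1 hs).1
  simp only [IsTorusGap] at hx hy
  obtain rfl | rfl | ⟨h2, h3⟩ | rfl | rfl :
      t = 0 ∨ t = 1 ∨ (2 ≤ t ∧ t < q + 2) ∨ t = q + 2 ∨ t = q + 3 := by omega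
  · obtain rfl : maxAt 0 = s := by simpa [torusWord] using hs
    simp only [SliceKind.inputs, SliceKind.outputs] at hg
    simp only [gapLabel]
    grind
  · obtain rfl : maxAt 1 = s := by simpa [torusWord] using hs
    simp only [SliceKind.inputs, SliceKind.outputs] at hg
    simp only [gapLabel]
    grind
  · obtain rfl : crossAt 1 0 = s := by
      simpa [torusWord_getElem?_crossing 1 h2 h3] using hs
    simp only [SliceKind.inputs, SliceKind.outputs] at hg
    simp only [gapLabel]
    grind
  · obtain rfl : minAt 1 = s := by simpa [torusWord_getElem?_min_one] using hs
    simp only [SliceKind.inputs, SliceKind.outputs] at hg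
    simp only [gapLabel]
    grind
  · obtain rfl : minAt 0 = s := by simpa [torusWord_getElem?_min_zero] using hs
    simp only [SliceKind.inputs, SliceKind.outputs] at hg
    simp only [gapLabel]
    grind

/-- The number of a face of `T(2, q)`. -/
def faceLabel {q : ℕ} : Face (torusWord 1 q) → ℕ :=
  Quot.lift (fun x => gapLabel q x.1.1 x.1.2) fun _ _ => gapLabel_eq_of_gapAdj

theorem faceLabel_gapFace {q t g : ℕ} (h : IsTorusGap q t g) :
    faceLabel (gapFace q t g) = gapLabel q t g := by
  rw [gapFace, dif_pos h]; rfl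

/-- A gap in the face with a given number. -/
noncomputable def labelFace (q j : ℕ) : Face (torusWord 1 q) :=
  if j = 0 then gapFace q 0 0 else if j = q + 1 then gapFace q 2 2 else gapFace q (j + 2) 1

theorem gapFace_braid {q t g : ℕ} (ht : t ≤ q) (hg : g = 0 ∨ g = 2 ∨ g = 3 ∨ g = 4) :
    gapFace q (t + 2) g = gapFace q 2 g := by
  induction t with
  | zero => rfl
  | succ t ih =>
    rw [← ih (by omega)]
    refine (gapFace_eq_of_slice (s := crossAt 1 0) ?_ ?_
      (torusWord_getElem?_crossing 1 (by omega) (by omega)) ?_).symm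
    · simp only [IsTorusGap]; grind
    · simp only [IsTorusGap]; grind
    · simp only [SliceKind.inputs, SliceKind.outputs]
      rcases hg with rfl | rfl | rfl | rfl
      · simp
      · exact Or.inr ⟨0, rfl, rfl⟩
      · exact Or.inr ⟨1, rfl, rfl⟩
      · exact Or.inr ⟨2, rfl, rfl⟩

/-- The converse direction: each gap is joined to the representative of its label by a chain of
adjacent gaps, so the label determines the face. For `q = 0` the labels of the outside and of an
omitted face would collide. -/
theorem gapFace_eq_labelFace {q t g : ℕ} (hq : 0 < q) (h : IsTorusGap q t g) :
    gapFace q t g = labelFace q (gapLabel q t g) := by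
  have gap {t g : ℕ} (h : t ≤ q + 4 ∧
      g ≤ if t = 0 ∨ t = q + 4 then 0 else if t = 1 ∨ t = q + 3 then 2 else 4) :
      IsTorusGap q t g := h
  -- The `a`s pass the two maxima, the `b`s the two minima, and the `c`s run along the braid. In
  -- particular the regions just above and just below the braid are joined through the right-hand
  -- closing strands.
  have a1 : gapFace q 0 0 = gapFace q 1 0 := gapFace_eq_of_slice (s := maxAt 0)
    (gap (by grind)) (gap (by grind)) (by simp [torusWord]) (by simp)
  have a2 : gapFace q 0 0 = gapFace q 1 2 := gapFace_eq_of_slice (s := maxAt 0)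
    (gap (by grind)) (gap (by grind)) (by simp [torusWord])
    (by simp [SliceKind.inputs, SliceKind.outputs])
  have a3 : gapFace q 1 0 = gapFace q 2 0 := gapFace_eq_of_slice (s := maxAt 1)
    (gap (by grind)) (gap (by grind)) (by simp [torusWord]) (by simp)
  have a4 : gapFace q 1 1 = gapFace q 2 1 := gapFace_eq_of_slice (s := maxAt 1)
    (gap (by grind)) (gap (by grind)) (by simp [torusWord]) (by simp)
  have a5 : gapFace q 1 1 = gapFace q 2 3 := gapFace_eq_of_slice (s := maxAt 1)
    (gap (by grind)) (gap (by grind)) (by simp [torusWord])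
    (by simp [SliceKind.inputs, SliceKind.outputs])
  have a6 : gapFace q 1 2 = gapFace q 2 4 := gapFace_eq_of_slice (s := maxAt 1)
    (gap (by grind)) (gap (by grind)) (by simp [torusWord])
    (Or.inr ⟨1, by simp [SliceKind.inputs, SliceKind.outputs]⟩)
  have b1 : gapFace q (q + 2) 0 = gapFace q (q + 3) 0 := gapFace_eq_of_slice (s := minAt 1)
    (gap (by grind)) (gap (by grind)) (torusWord_getElem?_min_one 1 q) (by simp)
  have b2 : gapFace q (q + 2) 1 = gapFace q (q + 3) 1 := gapFace_eq_of_slice (s := minAt 1)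
    (gap (by grind)) (gap (by grind)) (torusWord_getElem?_min_one 1 q) (by simp)
  have b3 : gapFace q (q + 2) 3 = gapFace q (q + 3) 1 := gapFace_eq_of_slice (s := minAt 1)
    (gap (by grind)) (gap (by grind)) (torusWord_getElem?_min_one 1 q)
    (Or.inr ⟨0, by simp [SliceKind.inputs, SliceKind.outputs]⟩)
  have b4 : gapFace q (q + 2) 4 = gapFace q (q + 3) 2 := gapFace_eq_of_slice (s := minAt 1)
    (gap (by grind)) (gap (by grind)) (torusWord_getElem?_min_one 1 q)
    (Or.inr ⟨1, by simp [SliceKind.inputs, SliceKind.outputs]⟩)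
  have b5 : gapFace q (q + 3) 0 = gapFace q (q + 4) 0 := gapFace_eq_of_slice (s := minAt 0)
    (gap (by grind)) (gap (by grind)) (torusWord_getElem?_min_zero 1 q) (by simp)
  have c0 := gapFace_braid (q := q) le_rfl (g := 0) (by simp)
  have c3 := gapFace_braid (q := q) le_rfl (g := 3) (by simp)
  have c4 := gapFace_braid (q := q) le_rfl (g := 4) (by simp)
  simp only [IsTorusGap] at h
  obtain rfl | rfl | ⟨h2, h3⟩ | rfl | rfl :
      t = 0 ∨ t = 1 ∨ (2 ≤ t ∧ t ≤ q + 2) ∨ t = q + 3 ∨ t = q + 4 := by omega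
  · obtain rfl : g = 0 := by simpa using h.2
    simp [gapLabel, labelFace]
  · obtain rfl | rfl | rfl : g = 0 ∨ g = 1 ∨ g = 2 := by grind
    · simp [gapLabel, labelFace, a1]
    · simp [gapLabel, labelFace, hq.ne', a5, b2, ← b3, c3]
    · simp [gapLabel, labelFace, a2]
  · obtain ⟨t, rfl⟩ := Nat.exists_eq_add_of_le' h2
    have h4 : g ≤ 4 := by grind
    have h5 : ¬ (t + 2 ≤ 1 ∨ q + 3 ≤ t + 2) := by omega
    rw [gapLabel, if_neg h5]
    interval_cases g
    · simp [labelFace, a1, a3, gapFace_braid (show t ≤ q by omega)]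
    · by_cases h6 : t = 0
      · subst h6
        simp [labelFace, hq.ne', b2, ← b3, c3, ← a4, a5]
      · have h7 : t ≠ q + 1 := by omega
        simp [labelFace, h6, h7]
    · simp [labelFace, gapFace_braid (show t ≤ q by omega)]
    · simp [labelFace, hq.ne', gapFace_braid (show t ≤ q by omega), b2, ← b3, c3]
    · simp [labelFace, gapFace_braid (show t ≤ q by omega), a2, a6]
  · obtain rfl | rfl | rfl : g = 0 ∨ g = 1 ∨ g = 2 := by grind
    · simp [gapLabel, labelFace, ← b1, c0, a1, a3]
    · simp [gapLabel, labelFace, hq.ne', b2]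
    · simp [gapLabel, labelFace, ← b4, c4, a2, a6]
  · obtain rfl : g = 0 := by simpa using h.2
    simp [gapLabel, labelFace, ← b5, ← b1, c0, a1, a3]

theorem labelFace_faceLabel {q : ℕ} (hq : 0 < q) (f : Face (torusWord 1 q)) :
    labelFace q (faceLabel f) = f := by
  obtain ⟨x, rfl⟩ := Quot.exists_rep f
  exact (gapFace_eq_labelFace hq (isTorusGap_iff.2 x.2)).symm.trans (faceOf_eq_gapFace x).symm

theorem faceLabel_injective {q : ℕ} (hq : 0 < q) :
    Function.Injective (faceLabel (q := q)) :=
  Function.LeftInverse.injective (labelFace_faceLabel hq)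

theorem faceLabel_labelFace {q j : ℕ} (hj : j < q) : faceLabel (labelFace q j) = j := by
  rw [labelFace, if_neg (show j ≠ q + 1 by omega)]
  split_ifs with h
  · rw [faceLabel_gapFace (by simp [IsTorusGap]), h]
    simp [gapLabel]
  · rw [faceLabel_gapFace (by simp only [IsTorusGap]; grind), gapLabel]
    grind

theorem faceLabel_le {q : ℕ} (f : Face (torusWord 1 q)) : faceLabel f ≤ q + 1 := by
  obtain ⟨x, rfl⟩ := Quot.exists_rep f
  change gapLabel q x.1.1 x.1.2 ≤ q + 1
  simp only [gapLabel]
  grind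

theorem shaded_labelFace_iff {q j : ℕ} (hj : j < q) : (labelFace q j).Shaded ↔ j ≠ 0 := by
  rw [labelFace, if_neg (show j ≠ q + 1 by omega)]
  split_ifs with h
  · rw [gapFace, dif_pos (by simp [IsTorusGap])]
    simp [Face.Shaded, faceOf, h]
  · rw [gapFace, dif_pos (by simp only [IsTorusGap]; grind)]
    simp [Face.Shaded, faceOf, h]

theorem faceLabel_torusFace {q g : ℕ} (hg : g ≤ 4) :
    faceLabel (torusFace q g hg) = gapLabel q 2 g := rfl

/-! ### The Tait graph of T(2, q) as a fan with activity letters. -/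

theorem torusWord_getElem?_eq_cross_iff {q t : ℕ} {s : ℤˣ} {i : ℕ} :
    (torusWord 1 q)[t]? = some (crossAt s i) ↔ (2 ≤ t ∧ t < q + 2) ∧ s = 1 ∧ i = 0 := by
  constructor
  · intro h
    have ht : t < q + 4 := by
      rw [← torusWord_length 1 q]
      exact (List.getElem?_eq_some_iff.1 h).1
    obtain rfl | rfl | ⟨h2, h3⟩ | rfl | rfl :
        t = 0 ∨ t = 1 ∨ (2 ≤ t ∧ t < q + 2) ∨ t = q + 2 ∨ t = q + 3 := by omega
    · simp [torusWord] at h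
    · simp [torusWord] at h
    · rw [torusWord_getElem?_crossing 1 h2 h3] at h
      simp only [Option.some.injEq, Slice.mk.injEq, SliceKind.crossing.injEq] at h
      exact ⟨⟨h2, h3⟩, h.1.symm, h.2.symm⟩
    · simp [torusWord_getElem?_min_one] at h
    · simp [torusWord_getElem?_min_zero] at h
  · rintro ⟨⟨h1, h2⟩, rfl, rfl⟩
    exact torusWord_getElem?_crossing 1 h1 h2

/-- The crossings of `T(2, q)`, numbered from the top. -/
def torusCrossing (q : ℕ) : Fin q ≃ Crossing (torusWord 1 q) where
  toFun k := ⟨k.1 + 2, 1, 0, torusWord_getElem?_crossing 1 (by omega) (by omega)⟩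
  invFun v := ⟨v.1 - 2, by
    obtain ⟨t, s, i, h⟩ := v
    have := (torusWord_getElem?_eq_cross_iff.1 h).1
    simp only
    omega⟩
  left_inv k := by simp
  right_inv v := by
    obtain ⟨t, s, i, h⟩ := v
    have := (torusWord_getElem?_eq_cross_iff.1 h).1
    simp only [Subtype.mk.injEq]
    omega

/-- The faces of `T(2, q)` other than the two omitted ones. -/
noncomputable def torusRemainingFace (q : ℕ) (hq : 0 < q) :
    Fin q ≃ RemainingFace (torusWord 1 q) (torusFace q 3 (by norm_num))
      (torusFace q 2 (by norm_num)) where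
  toFun j := ⟨labelFace q j, by
    constructor <;> intro h <;> have h := congrArg faceLabel h <;>
      rw [faceLabel_labelFace j.2, faceLabel_torusFace] at h <;>
      simp [gapLabel] at h <;> omega⟩
  invFun f := ⟨faceLabel f.1, by
    have h1 := (faceLabel_injective hq).ne f.2.1
    have h2 := (faceLabel_injective hq).ne f.2.2
    have h3 := faceLabel_le f.1
    rw [faceLabel_torusFace] at h1 h2
    simp [gapLabel] at h1 h2
    omega⟩
  left_inv j := Fin.ext (faceLabel_labelFace j.2)
  right_inv f := Subtype.ext (labelFace_faceLabel hq f.1)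

/-- The gaps above and below crossing `k` carry the labels `k` and `k + 1`, except at the two ends
of the braid, where they lie in the omitted face `q`. The formula survives there: for `k = 0` the
condition `j = k` repeats `j = 0`, and for `k = q - 1` the value `k + 1` is no label in `Fin q`. -/
theorem touches_iff {q : ℕ} (hq : 0 < q) (k j : Fin q) :
    Touches (torusWord 1 q) (torusCrossing q k) (labelFace q j) ↔
      j.1 = 0 ∨ j.1 = k.1 ∨ j.1 = k.1 + 1 := by
  have key (t g : ℕ) (h : IsTorusGap q t g) :
      (∃ x : Gap (torusWord 1 q), faceOf _ x = labelFace q j ∧ x.1 = (t, g)) ↔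
        gapLabel q t g = j := by
    constructor
    · rintro ⟨x, hx, hx'⟩
      rw [faceOf_eq_gapFace, hx'] at hx
      rw [← faceLabel_gapFace h, hx, faceLabel_labelFace j.2]
    · intro hx
      exact ⟨⟨(t, g), isTorusGap_iff.1 h⟩, by
        rw [faceOf_eq_gapFace, gapFace_eq_labelFace hq h, hx], rfl⟩
  have h1 : Touches (torusWord 1 q) (torusCrossing q k) (labelFace q j) ↔
      gapLabel q (k + 2) 0 = j ∨ gapLabel q (k + 2) 2 = j ∨ gapLabel q (k + 2) 1 = j ∨
        gapLabel q (k + 2 + 1) 1 = j := by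
    rw [← key _ _ (by simp only [IsTorusGap]; grind), ← key _ _ (by simp only [IsTorusGap]; grind),
      ← key _ _ (by simp only [IsTorusGap]; grind), ← key _ _ (by simp only [IsTorusGap]; grind)]
    simp only [← exists_or, ← and_or_left]
    constructor
    · rintro ⟨s, i, h, h'⟩
      obtain ⟨-, -, rfl⟩ := torusWord_getElem?_eq_cross_iff.1 h
      exact h'
    · intro h
      exact ⟨1, 0, torusWord_getElem?_crossing 1 (Nat.le_add_left _ _)
        (Nat.add_lt_add_right k.2 2), h⟩
  rw [h1]
  simp only [gapLabel]
  grind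

theorem isLowest_iff {q : ℕ} (hq : 0 < q) (k j : Fin q) :
    IsLowest (torusWord 1 q) (torusCrossing q k) (labelFace q j) ↔
      (j.1 = 0 ∧ k.1 = 0) ∨ j.1 = k.1 + 1 := by
  have h1 : IsLowest (torusWord 1 q) (torusCrossing q k) (labelFace q j) ↔
      (j.1 = 0 ∨ j.1 = k.1 ∨ j.1 = k.1 + 1) ∧
        ∀ l : Fin q, (j.1 = 0 ∨ j.1 = l.1 ∨ j.1 = l.1 + 1) → k.1 ≤ l.1 := by
    rw [IsLowest, touches_iff hq]
    refine and_congr_right fun _ => ?_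
    rw [← (torusCrossing q).forall_congr_right]
    refine forall_congr' fun l => ?_
    rw [touches_iff hq]
    simp [torusCrossing]
  rw [h1]
  constructor
  · rintro ⟨h2, h3⟩
    -- The candidates for the first crossing: `0` for the outside face and `j - 1` for the bigon
    -- `j`.
    have h4 := h3 ⟨0, hq⟩
    have h5 := h3 ⟨j.1 - 1, by omega⟩
    simp only at h4 h5
    omega
  · rintro (⟨h2, h3⟩ | h2)
    · exact ⟨Or.inl h2, fun l _ => by omega⟩
    · exact ⟨by omega, fun l hl => by omega⟩

theorem edgeLetter_torusWord {q : ℕ} (hq : 0 < q) (k j : Fin q) :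
    edgeLetter (torusWord 1 q) (torusCrossing q k) (labelFace q j) =
      if j.1 = 0 then (if k.1 = 0 then .ell else .d) else if j.1 = k.1 + 1 then .L else .D := by
  have h : IsPositiveCrossing (torusWord 1 q) (torusCrossing q k) :=
    ⟨1, 0, torusWord_getElem?_crossing 1 (Nat.le_add_left _ _)
      (Nat.add_lt_add_right k.2 2), by simp⟩
  rw [edgeLetter, if_pos h]
  simp only [shaded_labelFace_iff j.2, isLowest_iff hq]
  grind

/-! ### The activity polynomial -/

/-- The letter of the `k`-th crossing in the `i`-th matching. -/
def torusLetter (i k : ℕ) : ActivityLetter :=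
  if k < i then .L else if k = i then (if k = 0 then .ell else .d) else .D

theorem torusP_eq {q : ℕ} (hq : 0 < q) :
    torusP q = ∑ i ∈ Finset.range q, ∏ k ∈ Finset.range q, MvPolynomial.X (torusLetter i k) := by
  rw [torusP, activityPolynomial_eq_sum_fanMatching hq (torusCrossing q) (torusRemainingFace q hq)
    (touches_iff hq), Finset.sum_range]
  refine Finset.sum_congr rfl fun i _ => ?_
  rw [Finset.prod_range]
  refine Finset.prod_congr rfl fun k _ => ?_
  have h := edgeLetter_torusWord hq k (fanMatching i k)
  refine congrArg MvPolynomial.X (h.trans ?_)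
  rw [fanMatching_val, torusLetter]
  grind

theorem torusP_one : torusP 1 = MvPolynomial.X .ell := by
  simp [torusP_eq, torusLetter]

/-- Split by the crossing matched to the outside face. If it is not the last one, the last crossing
takes the bigon above it and contributes `D`; if it is, the last crossing contributes `d` and all
others contribute `L`. -/
theorem torusP_add_two (n : ℕ) :
    torusP (n + 2) = torusP (n + 1) * MvPolynomial.X .D +
      MvPolynomial.X .d * MvPolynomial.X .L ^ (n + 1) := by
  rw [torusP_eq (Nat.succ_pos _), torusP_eq (Nat.succ_pos _), Finset.sum_range_succ,
    Finset.sum_mul]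
  congr 1
  · refine Finset.sum_congr rfl fun i hi => ?_
    have hi := Finset.mem_range.1 hi
    rw [Finset.prod_range_succ]
    congr 2
    rw [torusLetter, if_neg (by omega), if_neg (by omega)]
  · have h : ∀ k ∈ Finset.range (n + 1), (MvPolynomial.X (torusLetter (n + 1) k) :
        MvPolynomial ActivityLetter ℤ) = MvPolynomial.X .L := fun k hk => by
      rw [torusLetter, if_pos (Finset.mem_range.1 hk)]
    rw [Finset.prod_range_succ, mul_comm, Finset.prod_congr rfl h, Finset.prod_const,
      Finset.card_range]
    simp [torusLetter]

theorem aPow_pow (m : ℤ) (n : ℕ) : aPow m ^ n = aPow (m * n) := by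
  induction n with
  | zero => simp [aPow_zero]
  | succ n ih =>
    rw [pow_succ, ih, ← aPow_add]
    congr 1
    push_cast; ring

end Knot

theorem mainTheorem5 (q : ℕ) (hq : 2 ≤ q) (s : ℤˣ) :
    (∀ K : Knot.LinkDiagram → Knot.AZ, Knot.IsKauffmanPolynomial K →
      K (Knot.torusLink s q) =
        MvPolynomial.aeval (Knot.specialize s) (Knot.torusP q) -
          ∑ i ∈ Finset.range (q - 1),
            Knot.zPow ((q : ℤ) - 2 - (i : ℤ)) * K (Knot.torusLink s i)) ∧
    Knot.skeinClass (Knot.torusLink s q) =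
      MvPolynomial.aeval (Knot.specialize s) (Knot.torusP q) • Knot.skeinClass Knot.unknot -
        ∑ i ∈ Finset.range (q - 1),
          Knot.zPow ((q : ℤ) - 2 - (i : ℤ)) • Knot.skeinClass (Knot.torusLink s i) := by
  obtain ⟨n, rfl⟩ := Nat.exists_eq_add_of_le' (show 1 ≤ q by omega)
  have h (i : ℕ) : ((n + 1 : ℕ) : ℤ) - 2 - i = (n : ℤ) - 1 - i := by push_cast; ring
  have h1 : MvPolynomial.aeval (Knot.specialize s) (Knot.torusP 1) = Knot.aPow (-(s : ℤ)) := by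
    rw [Knot.torusP_one, MvPolynomial.aeval_X, Knot.specialize]
  have h2 (m : ℕ) : MvPolynomial.aeval (Knot.specialize s) (Knot.torusP (m + 2)) =
      MvPolynomial.aeval (Knot.specialize s) (Knot.torusP (m + 1)) * Knot.zPow 1 +
        Knot.zPow 1 * Knot.aPow ((s : ℤ) * (m + 1 : ℕ)) := by
    simp only [Knot.torusP_add_two, map_add, map_mul, map_pow, MvPolynomial.aeval_X,
      Knot.specialize, Knot.aPow_pow]
  simp only [h, Nat.add_sub_cancel]
  refine ⟨fun K hK => ?_, Knot.skeinClass_isSkeinInvariant.torusLink_eq s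
    (fun m => MvPolynomial.aeval (Knot.specialize s) (Knot.torusP m)) h1 h2 n⟩
  -- Only here does the normalization `K(O) = 1` enter.
  have h3 := hK.isSkeinInvariant.torusLink_eq s
    (fun m => MvPolynomial.aeval (Knot.specialize s) (Knot.torusP m)) h1 h2 n
  simpa only [smul_eq_mul, hK.unknot, mul_one] using h3
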